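/- A tropical signomial on $\mathbb{R}^d$ is a function $g(x)=\max_{a\in A}(c_a+\langle a,x\rangle)$ given by a nonempty finite set $A\subset\mathbb{R}^d$ of exponents and coefficients $c_a\in\mathbb{R}$. Its monomial length $\mathtt{mlen}(g)$ is the number of monomials of $g$ in reduced form, i.e. the number of $a\in A$ such that removing the monomial $c_a+\langle a,x\rangle$ changes the function. For a piecewise linear function $f:\mathbb{R}^d\to\mathbb{R}$, let $\mathcal{V}(f)$ be its locus of non-linearity, i.e. the set of points having no neighbourhood on which $f$ is affine; the linear regions of $f$ are the connected components of $\mathbb{R}^d\setminus\mathcal{V}(f)$, and $r(\mathcal{V}(f))$ is their number. For a tropical signomial $g$, $\mathcal{V}(g)$ is a polyhedral complex whose closed cells are the sets of all $y$ at which every monomial attaining the maximum at $x$ attains the maximum, for $x\in\mathcal{V}(g)$. The cells of $\mathcal{V}(g)\cap\mathcal{V}(h)$ are the nonempty intersections of a cell of $\mathcal{V}(g)$ with a cell of $\mathcal{V}(h)$, and the Euler characteristic of a polyhedral complex $X$ is $\chi(X)=\sum_{P}(-1)^{\dim P}$, the sum over its (bounded and unbounded) nonempty closed cells. Let $d\ge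 0$ and let $\varphi=g\oslash h$ be a tropical rational signomial on $\mathbb{R}^d$, i.e. $\varphi(x)=g(x)-h(x)$ for tropical signomials $g,h$ on $\mathbb{R}^d$. Then $\varphi$ has finitely many linear regions, and \[ r(\mathcal{V}(\varphi))\le \mathtt{mlen}(g)+\mathtt{mlen}(h)+(-1)^{d+2}\,\chi(\mathcal{V}(g)\cap\mathcal{V}(h)). \] -/

import Mathlib

open scoped Matrix Topology

noncomputable section

/-- A tropical (max-plus) signomial `⨁ₐ c(a) ⊙ x^{⊙a}` in `d` variables: a nonempty finite set of
pairwise distinct real exponent vectors, each carrying a real coefficient. The values of `coeff`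
outside `exponents` are never used. -/
structure TropicalSignomial (d : ℕ) where
  exponents : Finset (Fin d → ℝ)
  exponents_nonempty : exponents.Nonempty
  coeff : (Fin d → ℝ) → ℝ

namespace TropicalSignomial

variable {d : ℕ}

/-- The monomial `c(a) ⊙ x^{⊙a}`, that is, the affine function `c(a) + ⟨a, x⟩`. -/
def monomial (g : TropicalSignomial d) (a x : Fin d → ℝ) : ℝ :=
  g.coeff a + a ⬝ᵥ x

/-- The real-valued function of `g`: the maximum of its monomials. -/
def eval (g : TropicalSignomial d) (x : Fin d → ℝ) : ℝ :=
  g.exponents.sup' g.exponents_nonempty fun a => g.monomial a x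

/-- The monomial with exponent `a` is redundant: the remaining monomials (at least one remains)
define the same real-valued function. -/
def Redundant (g : TropicalSignomial d) (a : Fin d → ℝ) : Prop :=
  ∃ hne : (g.exponents.erase a).Nonempty,
    ∀ x, ((g.exponents.erase a).sup' hne fun b => g.monomial b x) = g.eval x

/-- `g` is reduced: removing any one of its monomials changes the real-valued function. -/
def Reduced (g : TropicalSignomial d) : Prop :=
  ∀ a ∈ g.exponents, ¬ g.Redundant a

open Classical in
/-- The monomial length of `g`: the number of its monomials that are not redundant. -/
def mlen (g : TropicalSignomial d) : ℕ :=
  (g.exponents.filter fun a => ¬ g.Redundant a).card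

/-- For a reduced signomial the monomial length is the number of all of its monomials. -/
theorem mlen_of_reduced (g : TropicalSignomial d) (hg : g.Reduced) :
    g.mlen = g.exponents.card := by
  classical
  unfold mlen
  rw [Finset.filter_true_of_mem hg]

open Classical in
/-- The exponents of the monomials of `g` that attain the maximum at `x`. -/
def argmax (g : TropicalSignomial d) (x : Fin d → ℝ) : Finset (Fin d → ℝ) :=
  g.exponents.filter fun a => g.monomial a x = g.eval x

/-- The closed cell having `x` in its relative interior, in the polyhedral subdivision of `ℝᵈ`
induced by `g`. -/
def cell (g : TropicalSignomial d) (x : Fin d → ℝ) : Set (Fin d → ℝ) :=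
  {y | g.argmax x ⊆ g.argmax y}

end TropicalSignomial

/-- The locus of non-linearity `𝒱(f)` of a function `f : ℝᵈ → ℝ`: the points near which `f` does
not agree with any affine function. -/
def nonlinearLocus {d : ℕ} (f : (Fin d → ℝ) → ℝ) : Set (Fin d → ℝ) :=
  {x | ¬ ∃ l : (Fin d → ℝ) →ᵃ[ℝ] ℝ, ∀ᶠ y in 𝓝 x, f y = l y}

/-- The linear regions of `f`: the regions into which `𝒱(f)` divides `ℝᵈ`, that is, the connected
components of the complement of `𝒱(f)`. -/
def linearRegions {d : ℕ} (f : (Fin d → ℝ) → ℝ) : Set (Set (Fin d → ℝ)) :=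
  {U | ∃ x ∈ (nonlinearLocus f)ᶜ, U = connectedComponentIn (nonlinearLocus f)ᶜ x}

/-- The (closed, nonempty) cells of the tropical hypersurface `𝒱(g)` as a polyhedral complex. -/
def TropicalSignomial.hypersurface {d : ℕ} (g : TropicalSignomial d) :
    Set (Set (Fin d → ℝ)) :=
  {P | ∃ x ∈ nonlinearLocus g.eval, P = g.cell x}

/-- The intersection of two polyhedral complexes: its cells are the nonempty intersections of a
cell of the first with a cell of the second. -/
def complexInter {d : ℕ} (X Y : Set (Set (Fin d → ℝ))) : Set (Set (Fin d → ℝ)) :=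
  {R | R.Nonempty ∧ ∃ P ∈ X, ∃ Q ∈ Y, R = P ∩ Q}

/-- The dimension of a cell: the dimension of its affine span. -/
def cellDim {d : ℕ} (P : Set (Fin d → ℝ)) : ℕ :=
  Module.finrank ℝ (vectorSpan ℝ P)

/-- The Euler characteristic of a finite polyhedral complex, given by its nonempty cells: the
alternating sum of the numbers of cells in the different dimensions. -/
def eulerChar {d : ℕ} (X : Set (Set (Fin d → ℝ))) : ℤ :=
  ∑ᶠ P ∈ X, (-1 : ℤ) ^ cellDim P

/-- A tropical hypersurface has finitely many cells. -/
theorem TropicalSignomial.hypersurface_finite {d : ℕ} (g : TropicalSignomial d) :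
    g.hypersurface.Finite := by
  classical
  refine ((g.exponents.powerset.finite_toSet).image
    fun S => {y | S ⊆ g.argmax y}).subset ?_
  rintro P ⟨x, -, rfl⟩
  exact ⟨g.argmax x, Finset.mem_coe.2 (Finset.mem_powerset.2 (Finset.filter_subset _ _)), rfl⟩

/-- Hence the sum that defines the Euler characteristic of an intersection is finite. -/
theorem complexInter_finite {d : ℕ} {X Y : Set (Set (Fin d → ℝ))}
    (hX : X.Finite) (hY : Y.Finite) : (complexInter X Y).Finite := by
  refine ((hX.prod hY).image fun p => p.1 ∩ p.2).subset ?_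
  rintro R ⟨-, P, hP, Q, hQ, rfl⟩
  exact ⟨(P, Q), ⟨hP, hQ⟩, rfl⟩

end

/-! The proof counts by means of an Euler functional: a linear functional `E` on functions `ℝᵈ → ℚ`
sending the indicator of every nonempty relatively open convex set of dimension `k` to `(-1)^k`
(`exists_eulerFunctional`). Group the points of `ℝᵈ` by the set of monomials of `g` attaining the
maximum; these strata are relatively open, convex and partition the space. Hence the indicator of
`𝒱(g)` is `1 - ∑ₐ 1_{Gₐ}`, where `Gₐ` is the open stratum on which `a` attains the maximum alone;
the nonempty `Gₐ` number `mlen(g)`. Likewise for `h`, with strata `H_b`.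

Multiplying the two identities expresses the indicator of `𝒱(g) ∩ 𝒱(h)` through the `Gₐ`, the `H_b`
and the sets `Gₐ ∩ H_b`. The cells of the intersection correspond to the nonempty common strata,
their relative interiors, so applying `E` gives `χ = (-1)^d (1 - mlen(g) - mlen(h) + N)`, with `N`
the number of nonempty `Gₐ ∩ H_b` (`card_commonRegions`).

Finally `φ` is affine on each `Gₐ ∩ H_b`, and their union is dense, so each linear region contains
at least one of them (`linearRegions_subset_image`). This bounds the number of regions by `N`, one
better than required. -/

/-! ### The Euler functional on relatively open convex sets -/

/-- A convex set which is open in its affine span, with the direction `W` of that span: from each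
of its points one can move a little exactly in the directions of `W`. -/
def RelOpenConvex {E : Type*} [AddCommGroup E] [Module ℝ E] (C : Set E) (W : Submodule ℝ E) :
    Prop :=
  Convex ℝ C ∧ ∀ x ∈ C, ∀ w, w ∈ W ↔ ∃ ε : ℝ, 0 < ε ∧ x + ε • w ∈ C

/-- Prescribed values extend to a functional as soon as they respect all linear relations: the range
of a dual map is the annihilator of the kernel. -/
theorem exists_linearMap_of_relations {ι V : Type*} [AddCommGroup V] [Module ℚ V] (v : ι → V)
    (c : ι → ℚ) (hc : ∀ (s : Finset ι) (m : ι → ℚ), ∑ i ∈ s, m i • v i = 0 →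
      ∑ i ∈ s, m i * c i = 0) : ∃ E : V →ₗ[ℚ] ℚ, ∀ i, E (v i) = c i := by
  have h : Finsupp.linearCombination ℚ c ∈
      LinearMap.range (Finsupp.linearCombination ℚ v).dualMap := by
    rw [LinearMap.range_dualMap_eq_dualAnnihilator_ker, Submodule.mem_dualAnnihilator]
    intro m hm
    exact hc m.support m hm
  obtain ⟨E, hE⟩ := h
  refine ⟨E, fun i => ?_⟩
  have := LinearMap.congr_fun hE (Finsupp.single i 1)
  simpa using this

/-- Indices for the nonempty relatively open convex subsets of `ℝ`: points and open intervals. -/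
abbrev PointOrInterval : Type := ℝ ⊕ {q : EReal × EReal // q.1 < q.2}

namespace PointOrInterval

/-- The indicator function of a point or open interval. -/
noncomputable def ind : PointOrInterval → ℝ → ℚ :=
  Sum.elim (fun p => ({p} : Set ℝ).indicator 1)
    (fun q => {y : ℝ | q.1.1 < (y : EReal) ∧ (y : EReal) < q.1.2}.indicator 1)

/-- The lower end of a point or open interval. -/
def lower : PointOrInterval → EReal := Sum.elim (fun p => (p : EReal)) (fun q => q.1.1)

/-- The Euler characteristic of a point or open interval. -/
def sign : PointOrInterval → ℚ := Sum.elim (fun _ => 1) (fun _ => -1)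

end PointOrInterval

open Classical in
/-- The jump from the value at `k` to the value just above `k` of a real function given as a
combination of indicators of points and of open intervals. -/
theorem eventually_jump (k : ℝ) (i : PointOrInterval) :
    ∀ᶠ y : ℝ in 𝓝[>] k,
      i.ind k - i.ind y = if i.lower = k then i.sign else 0 := by
  have hcoe : Filter.Tendsto (fun y : ℝ => (y : EReal)) (𝓝[>] k) (𝓝 (k : EReal)) :=
    (continuous_coe_real_ereal.tendsto k).mono_left nhdsWithin_le_nhds
  rcases i with p | ⟨⟨a, b⟩, hab⟩
  · by_cases hp : p = k
    · subst hp
      filter_upwards [self_mem_nhdsWithin] with y hy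
      have : y ≠ p := ne_of_gt hy
      simp [PointOrInterval.ind, PointOrInterval.lower, PointOrInterval.sign, this]
    · have h1 : ∀ᶠ y : ℝ in 𝓝[>] k, y ≠ p :=
        nhdsWithin_le_nhds (isOpen_ne.mem_nhds (Ne.symm hp))
      filter_upwards [h1] with y hy
      simp [PointOrInterval.ind, PointOrInterval.lower, hy, hp, Ne.symm hp]
  · dsimp only at hab
    rcases lt_trichotomy a k with h | h | h
    · by_cases hb : (k : EReal) < b
      · filter_upwards [self_mem_nhdsWithin, hcoe.eventually (gt_mem_nhds hb)] with y hy hyb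
        have : a < y := h.trans (EReal.coe_lt_coe_iff.2 hy)
        simp [PointOrInterval.ind, PointOrInterval.lower, h, hb, this, hyb, h.ne]
      · filter_upwards [self_mem_nhdsWithin] with y hy
        have : ¬ (y : EReal) < b := fun h' => hb ((EReal.coe_lt_coe_iff.2 hy).trans h')
        simp [PointOrInterval.ind, PointOrInterval.lower, hb, this, h.ne]
    · subst h
      filter_upwards [self_mem_nhdsWithin, hcoe.eventually (gt_mem_nhds hab)] with y hy hyb
      have : k < y := hy
      simp [PointOrInterval.ind, PointOrInterval.lower, PointOrInterval.sign, this, hyb]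
    · filter_upwards [hcoe.eventually (gt_mem_nhds h)] with y hy
      simp [PointOrInterval.ind, PointOrInterval.lower, not_lt.2 hy.le, not_lt.2 h.le, h.ne']

-- The analogue at `-∞` of the jump: only intervals unbounded below are seen there.
open Classical in
theorem eventually_atBot_value (i : PointOrInterval) :
    ∀ᶠ y : ℝ in Filter.atBot,
      -i.ind y = if i.lower = ⊥ then i.sign else 0 := by
  rcases i with p | ⟨⟨a, b⟩, hab⟩
  · filter_upwards [Filter.eventually_lt_atBot p] with y hy
    simp [PointOrInterval.ind, PointOrInterval.lower, hy.ne]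
  · dsimp only at hab
    by_cases ha : a = ⊥
    · subst ha
      have : ∀ᶠ y : ℝ in Filter.atBot, (y : EReal) < b :=
        EReal.tendsto_coe_atBot.eventually (gt_mem_nhds hab)
      filter_upwards [this] with y hy
      simp [PointOrInterval.ind, PointOrInterval.lower, PointOrInterval.sign, hy]
    · have : ∀ᶠ y : ℝ in Filter.atBot, (y : EReal) < a :=
        EReal.tendsto_coe_atBot.eventually (gt_mem_nhds (bot_lt_iff_ne_bot.2 ha))
      filter_upwards [this] with y hy
      simp [PointOrInterval.ind, PointOrInterval.lower, ha, not_lt.2 hy.le]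

/-- Sorting a relation by lower ends, the part with lower end `k` has signed sum equal to the jump
at `k` of the zero function. -/
theorem exists_eulerFunctional_intervals : ∃ E : (ℝ → ℚ) →ₗ[ℚ] ℚ,
    (∀ p, E (({p} : Set ℝ).indicator 1) = 1) ∧
    ∀ a b : EReal, a < b → E ({y : ℝ | a < y ∧ (y : EReal) < b}.indicator 1) = -1 := by
  classical
  obtain ⟨E, hE⟩ := exists_linearMap_of_relations
    PointOrInterval.ind PointOrInterval.sign (by
      intro s m hm
      have hm' := fun y => congrFun hm y
      simp only [Finset.sum_apply, Pi.smul_apply, smul_eq_mul, Pi.zero_apply] at hm'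
      rw [← Finset.sum_fiberwise_of_maps_to
        (g := PointOrInterval.lower)
        (fun i hi => Finset.mem_image_of_mem _ hi)]
      refine Finset.sum_eq_zero fun k hk => ?_
      rw [Finset.sum_filter]
      induction k using EReal.rec with
      | bot =>
        obtain ⟨y, hy⟩ := ((Filter.eventually_all_finset s).2
          fun i _ => eventually_atBot_value i).exists
        have h0 : ∑ i ∈ s, m i * -i.ind y = 0 := by simp [hm' y]
        refine Eq.trans ?_ h0
        exact Finset.sum_congr rfl fun i hi => by rw [hy i hi, mul_ite, mul_zero]
      | coe k =>
        -- A single `y` just above `k` serves all the finitely many indices.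
        obtain ⟨y, hy⟩ := ((Filter.eventually_all_finset s).2
          fun i _ => eventually_jump k i).exists
        have h0 : ∑ i ∈ s, m i * (i.ind k - i.ind y) = 0 := by simp [mul_sub, hm']
        refine Eq.trans ?_ h0
        exact Finset.sum_congr rfl fun i hi => by rw [hy i hi, mul_ite, mul_zero]
      | top =>
        obtain ⟨i, -, hi⟩ := Finset.mem_image.1 hk
        rcases i with p | ⟨⟨a, b⟩, hab⟩
        · simp [PointOrInterval.lower] at hi
        · have : a = ⊤ := hi
          simp [this] at hab)
  exact ⟨E, fun p => hE (Sum.inl p), fun a b hab => hE (Sum.inr ⟨(a, b), hab⟩)⟩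

theorem RelOpenConvex.sub_mem {E : Type*} [AddCommGroup E] [Module ℝ E] {C : Set E}
    {W : Submodule ℝ E} (hC : RelOpenConvex C W) {x y : E} (hx : x ∈ C) (hy : y ∈ C) :
    y - x ∈ W :=
  (hC.2 x hx _).2 ⟨1, one_pos, by simpa using hy⟩

/-- The ends are the infimum and supremum in `EReal`; neither is attained, since every point can be
moved both ways inside `C`. -/
theorem RelOpenConvex.eq_interval {C : Set ℝ} (hC : RelOpenConvex C ⊤) (hne : C.Nonempty) :
    ∃ a b : EReal, a < b ∧ C = {y : ℝ | a < y ∧ (y : EReal) < b} := by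
  have hlt : ∀ x ∈ C, sInf ((↑) '' C : Set EReal) < x ∧ (x : EReal) < sSup ((↑) '' C) := by
    intro x hx
    obtain ⟨ε, hε, h1⟩ := (hC.2 x hx (-1)).1 trivial
    obtain ⟨δ, hδ, h2⟩ := (hC.2 x hx 1).1 trivial
    constructor
    · refine (sInf_le (Set.mem_image_of_mem _ h1)).trans_lt (EReal.coe_lt_coe_iff.2 ?_)
      simpa using hε
    · refine (EReal.coe_lt_coe_iff.2 ?_).trans_le (le_sSup (Set.mem_image_of_mem _ h2))
      simpa using hδ
  obtain ⟨x, hx⟩ := hne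
  refine ⟨_, _, (hlt x hx).1.trans (hlt x hx).2, Set.Subset.antisymm hlt ?_⟩
  rintro y ⟨h1, h2⟩
  obtain ⟨-, ⟨u, hu, rfl⟩, hu'⟩ := sInf_lt_iff.1 h1
  obtain ⟨-, ⟨v, hv, rfl⟩, hv'⟩ := lt_sSup_iff.1 h2
  exact hC.1.ordConnected.out hu hv
    ⟨(EReal.coe_lt_coe_iff.1 hu').le, (EReal.coe_lt_coe_iff.1 hv').le⟩

theorem exists_eulerFunctional_real : ∃ E : (ℝ → ℚ) →ₗ[ℚ] ℚ, ∀ (C : Set ℝ) (W : Submodule ℝ ℝ),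
    RelOpenConvex C W → C.Nonempty → E (C.indicator 1) = (-1) ^ Module.finrank ℝ W := by
  obtain ⟨E, h1, h2⟩ := exists_eulerFunctional_intervals
  refine ⟨E, fun C W hC hne => ?_⟩
  rcases eq_bot_or_eq_top W with rfl | rfl
  · obtain ⟨x, hx⟩ := hne
    have : C = {x} := Set.eq_singleton_iff_unique_mem.2
      ⟨hx, fun y hy => sub_eq_zero.1 ((Submodule.mem_bot ℝ).1 (hC.sub_mem hx hy))⟩
    rw [this, h1]
    simp
  · obtain ⟨a, b, hab, rfl⟩ := hC.eq_interval hne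
    rw [h2 a b hab]
    simp

/-- The embedding of `ℝᵈ` into `ℝᵈ⁺¹` as the hyperplane where the first coordinate vanishes. -/
def consZero (d : ℕ) : (Fin d → ℝ) →ₗ[ℝ] (Fin (d + 1) → ℝ) where
  toFun v := Fin.cons 0 v
  map_add' v w := by ext i; cases i using Fin.cases <;> simp
  map_smul' c v := by ext i; cases i using Fin.cases <;> simp

/-- Rank-nullity for the first coordinate restricted to `W`. -/
theorem finrank_eq_proj_add_slice {d : ℕ} (W : Submodule ℝ (Fin (d + 1) → ℝ)) :
    Module.finrank ℝ W =
      Module.finrank ℝ (W.map (LinearMap.proj (φ := fun _ => ℝ) (0 : Fin (d + 1)))) +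
        Module.finrank ℝ (W.comap (consZero d)) := by
  set π : (Fin (d + 1) → ℝ) →ₗ[ℝ] ℝ := LinearMap.proj 0
  have hinj : Function.Injective (consZero d) := fun v w h =>
    (Fin.cons_injective2 (α := fun _ => ℝ) h).2
  have hker : LinearMap.range (consZero d) = LinearMap.ker π := by
    ext v
    constructor
    · rintro ⟨w, rfl⟩
      rfl
    · intro hv
      refine ⟨Fin.tail v, ?_⟩
      have : v 0 = 0 := hv
      conv_rhs => rw [← Fin.cons_self_tail v, this]
      rfl
  rw [← LinearMap.finrank_range_add_finrank_ker (π.domRestrict W), LinearMap.range_domRestrict]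
  congr 1
  have hmap : (LinearMap.ker (π.domRestrict W)).map W.subtype =
      (W.comap (consZero d)).map (consZero d) := by
    rw [Submodule.map_comap_eq, hker]
    ext v
    simp [and_comm]
  rw [← Submodule.finrank_map_subtype_eq, hmap]
  exact ((W.comap (consZero d)).equivMapOfInjective _ hinj).finrank_eq.symm

/-- Fubini: integrate over slices with fixed first coordinate, then over that coordinate. All
nonempty slices of `C` share one direction, so the inner result is a constant sign times the
indicator of the projection of `C`. -/
theorem exists_eulerFunctional (d : ℕ) : ∃ E : ((Fin d → ℝ) → ℚ) →ₗ[ℚ] ℚ,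
    ∀ (C : Set (Fin d → ℝ)) (W : Submodule ℝ (Fin d → ℝ)),
      RelOpenConvex C W → C.Nonempty → E (C.indicator 1) = (-1) ^ Module.finrank ℝ W := by
  induction d with
  | zero =>
    refine ⟨LinearMap.proj 0, fun C W _ ⟨x, hx⟩ => ?_⟩
    have h0 : (0 : Fin 0 → ℝ) ∈ C := by rwa [Subsingleton.elim (0 : Fin 0 → ℝ) x]
    have : Module.finrank ℝ W = 0 := Module.finrank_zero_of_subsingleton
    rw [LinearMap.proj_apply, Set.indicator_of_mem h0, this]
    rfl
  | succ d ih =>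
    obtain ⟨E, hE⟩ := ih
    obtain ⟨E₁, hE₁⟩ := exists_eulerFunctional_real
    refine ⟨E₁ ∘ₗ
      { toFun := fun f t => E fun v => f (Fin.cons t v)
        map_add' := fun f g => funext fun t => E.map_add (fun v => f (Fin.cons t v)) _
        map_smul' := fun c f => funext fun t => E.map_smul c (fun v => f (Fin.cons t v)) },
      fun C W hC hne => ?_⟩
    have hslice : ∀ t, RelOpenConvex {v : Fin d → ℝ | (Fin.cons t v : Fin (d + 1) → ℝ) ∈ C}
        (W.comap (consZero d)) := by
      intro t
      constructor
      · intro v hv w hw a b ha hb hab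
        have := hC.1 hv hw ha hb hab
        have e : a • (Fin.cons t v : Fin (d + 1) → ℝ) + b • (Fin.cons t w : Fin (d + 1) → ℝ) =
            Fin.cons t (a • v + b • w) := by
          ext i
          cases i using Fin.cases
          · simp [← add_mul, hab]
          · simp
        rwa [e] at this
      · intro v hv w
        rw [Submodule.mem_comap, hC.2 _ hv]
        have e : ∀ ε : ℝ, (Fin.cons t v : Fin (d + 1) → ℝ) + ε • consZero d w =
            Fin.cons t (v + ε • w) := by
          intro ε
          ext i
          cases i using Fin.cases <;> simp [consZero]
        simp only [e, Set.mem_ofPred_eq]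
    set π : (Fin (d + 1) → ℝ) →ₗ[ℝ] ℝ := LinearMap.proj 0 with hπ
    have hproj : RelOpenConvex (π '' C) (W.map π) := by
      refine ⟨hC.1.linear_image π, ?_⟩
      rintro - ⟨x, hx, rfl⟩ s
      constructor
      · rintro ⟨w, hw, rfl⟩
        obtain ⟨ε, hε, h⟩ := (hC.2 x hx w).1 hw
        exact ⟨ε, hε, _, h, by simp⟩
      · rintro ⟨ε, hε, z, hz, h⟩
        refine ⟨ε⁻¹ • (z - x), W.smul_mem _ (hC.sub_mem hx hz), ?_⟩
        rw [map_smul, map_sub, h]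
        simp [hε.ne']
    have key : (fun t => E fun v => C.indicator 1 (Fin.cons t v : Fin (d + 1) → ℝ)) =
        ((-1 : ℚ) ^ Module.finrank ℝ (W.comap (consZero d))) • (π '' C).indicator 1 := by
      funext t
      have e : (fun v => C.indicator (1 : (Fin (d + 1) → ℝ) → ℚ) (Fin.cons t v : Fin (d + 1) → ℝ)) =
          {v : Fin d → ℝ | (Fin.cons t v : Fin (d + 1) → ℝ) ∈ C}.indicator 1 := rfl
      rw [e]
      by_cases ht : t ∈ π '' C
      · obtain ⟨x, hx, rfl⟩ := id ht
        rw [hE _ _ (hslice _) ⟨Fin.tail x, by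
          change (Fin.cons (x 0) (Fin.tail x) : Fin (d + 1) → ℝ) ∈ C
          rwa [Fin.cons_self_tail]⟩]
        simp [ht]
      · have : {v : Fin d → ℝ | (Fin.cons t v : Fin (d + 1) → ℝ) ∈ C} = ∅ := by
          refine Set.eq_empty_of_forall_notMem fun v hv => ht ⟨_, hv, by simp [hπ]⟩
        rw [this, Set.indicator_empty', map_zero]
        simp [ht]
    rw [LinearMap.comp_apply]
    change E₁ (fun t => E fun v => C.indicator 1 (Fin.cons t v : Fin (d + 1) → ℝ)) = _
    rw [key, map_smul, hE₁ _ _ hproj (hne.image _), finrank_eq_proj_add_slice W, pow_add,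
      smul_eq_mul, mul_comm]

/-! ### Operations on relatively open convex sets -/

theorem RelOpenConvex.inter {E : Type*} [AddCommGroup E] [Module ℝ E] {C D : Set E}
    {W Z : Submodule ℝ E} (hC : RelOpenConvex C W) (hD : RelOpenConvex D Z) :
    RelOpenConvex (C ∩ D) (W ⊓ Z) := by
  refine ⟨hC.1.inter hD.1, fun x hx w => ⟨fun hw => ?_, ?_⟩⟩
  · obtain ⟨ε, hε, h1⟩ := (hC.2 x hx.1 w).1 hw.1
    obtain ⟨δ, hδ, h2⟩ := (hD.2 x hx.2 w).1 hw.2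
    have shrink : ∀ {s : Set E} {η : ℝ}, Convex ℝ s → x ∈ s → x + η • w ∈ s → 0 < η →
        min ε δ ≤ η → x + min ε δ • w ∈ s := by
      intro s η hs hx' h hη hle
      have := hs.add_smul_mem hx' h
        (t := min ε δ / η) ⟨(div_pos (lt_min hε hδ) hη).le, (div_le_one hη).2 hle⟩
      rwa [smul_smul, div_mul_cancel₀ _ hη.ne'] at this
    exact ⟨min ε δ, lt_min hε hδ, shrink hC.1 hx.1 h1 hε (min_le_left _ _),
      shrink hD.1 hx.2 h2 hδ (min_le_right _ _)⟩
  · rintro ⟨ε, hε, h1, h2⟩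
    exact ⟨(hC.2 x hx.1 w).2 ⟨ε, hε, h1⟩, (hD.2 x hx.2 w).2 ⟨ε, hε, h2⟩⟩

theorem relOpenConvex_univ {E : Type*} [AddCommGroup E] [Module ℝ E] :
    RelOpenConvex (Set.univ : Set E) ⊤ :=
  ⟨convex_univ, fun _ _ _ => ⟨fun _ => ⟨1, one_pos, trivial⟩, fun _ => trivial⟩⟩

theorem eventually_add_smul {E : Type*} [AddCommGroup E] [Module ℝ E] [TopologicalSpace E]
    [ContinuousAdd E] [ContinuousSMul ℝ E] {x : E} {p : E → Prop} (h : ∀ᶠ y in 𝓝 x, p y)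
    (w : E) : ∀ᶠ ε : ℝ in 𝓝[>] 0, p (x + ε • w) := by
  have hc : Filter.Tendsto (fun ε : ℝ => x + ε • w) (𝓝 0) (𝓝 x) := by
    have : Continuous fun ε : ℝ => x + ε • w := by fun_prop
    simpa using this.tendsto 0
  exact (hc.mono_left nhdsWithin_le_nhds).eventually h

/-! ### Strata of a single signomial -/

namespace TropicalSignomial

variable {d : ℕ} (g : TropicalSignomial d)

theorem mem_argmax {x a : Fin d → ℝ} :
    a ∈ g.argmax x ↔ a ∈ g.exponents ∧ g.monomial a x = g.eval x := by
  simp [argmax]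

theorem monomial_le_eval {a : Fin d → ℝ} (ha : a ∈ g.exponents) (x : Fin d → ℝ) :
    g.monomial a x ≤ g.eval x :=
  Finset.le_sup' (fun a => g.monomial a x) ha

theorem argmax_nonempty (x : Fin d → ℝ) : (g.argmax x).Nonempty := by
  obtain ⟨a, ha, h⟩ := Finset.exists_mem_eq_sup' g.exponents_nonempty fun a => g.monomial a x
  exact ⟨a, (g.mem_argmax).2 ⟨ha, h.symm⟩⟩

theorem argmax_subset (x : Fin d → ℝ) : g.argmax x ⊆ g.exponents :=
  fun _ ha => ((g.mem_argmax).1 ha).1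

theorem monomial_combo (a x y : Fin d → ℝ) {s t : ℝ} (hst : s + t = 1) :
    g.monomial a (s • x + t • y) = s * g.monomial a x + t * g.monomial a y := by
  obtain rfl : t = 1 - s := by linarith
  simp only [monomial, dotProduct_add, dotProduct_smul, smul_eq_mul]
  ring

theorem monomial_add_smul (a x w : Fin d → ℝ) (t : ℝ) :
    g.monomial a (x + t • w) = g.monomial a x + t * (a ⬝ᵥ w) := by
  simp only [monomial, dotProduct_add, dotProduct_smul, smul_eq_mul]
  ring

theorem continuous_monomial (a : Fin d → ℝ) : Continuous (g.monomial a) := by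
  unfold monomial
  exact continuous_const.add (continuous_const.dotProduct continuous_id)

theorem continuous_eval : Continuous g.eval :=
  Continuous.finset_sup'_apply _ fun a _ => g.continuous_monomial a

/-- At an inner point of a segment, the monomials attaining the maximum are those attaining it at
both ends, if there is one. -/
theorem argmax_combo {x y : Fin d → ℝ} {s t : ℝ} (hs : 0 < s) (ht : 0 < t) (hst : s + t = 1)
    {c : Fin d → ℝ} (hx : c ∈ g.argmax x) (hy : c ∈ g.argmax y) {a : Fin d → ℝ} :
    a ∈ g.argmax (s • x + t • y) ↔ a ∈ g.argmax x ∧ a ∈ g.argmax y := by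
  rw [mem_argmax] at hx hy
  have hev : g.eval (s • x + t • y) = s * g.eval x + t * g.eval y := by
    refine le_antisymm (Finset.sup'_le _ _ fun b hb => ?_) ?_
    · rw [g.monomial_combo _ _ _ hst]
      have := g.monomial_le_eval hb x
      have := g.monomial_le_eval hb y
      gcongr
    · rw [← hx.2, ← hy.2, ← g.monomial_combo _ _ _ hst]
      exact g.monomial_le_eval hx.1 _
  simp only [mem_argmax, hev, g.monomial_combo _ _ _ hst]
  constructor
  · rintro ⟨ha, h⟩
    have h1 := g.monomial_le_eval ha x
    have h2 := g.monomial_le_eval ha y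
    have h3 := mul_le_mul_of_nonneg_left h1 hs.le
    have h4 := mul_le_mul_of_nonneg_left h2 ht.le
    exact ⟨⟨ha, mul_left_cancel₀ hs.ne' (by linarith)⟩,
      ha, mul_left_cancel₀ ht.ne' (by linarith)⟩
  · rintro ⟨⟨ha, h1⟩, -, h2⟩
    exact ⟨ha, by rw [h1, h2]⟩

/-- Finitely many strict inequalities persist nearby, so no new monomial becomes active. -/
theorem eventually_argmax_subset (x : Fin d → ℝ) :
    ∀ᶠ y in 𝓝 x, g.argmax y ⊆ g.argmax x := by
  have h : ∀ a ∈ g.exponents, ∀ᶠ y in 𝓝 x, a ∈ g.argmax y → a ∈ g.argmax x := by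
    intro a ha
    by_cases hax : a ∈ g.argmax x
    · exact Filter.Eventually.of_forall fun _ _ => hax
    · have hlt : g.monomial a x < g.eval x :=
        lt_of_le_of_ne (g.monomial_le_eval ha x) fun h => hax ((g.mem_argmax).2 ⟨ha, h⟩)
      filter_upwards [(g.continuous_monomial a).continuousAt.eventually_lt
        g.continuous_eval.continuousAt hlt] with y hy hay
      exact absurd ((g.mem_argmax).1 hay).2 hy.ne
  filter_upwards [(Filter.eventually_all_finset _).2 h] with y hy a ha
  exact hy a (g.argmax_subset y ha) ha

/-- The directions along which all exponents in `A` have the same slope. -/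
def equalSlopes (A : Finset (Fin d → ℝ)) : Submodule ℝ (Fin d → ℝ) where
  carrier := {w | ∀ a ∈ A, ∀ b ∈ A, a ⬝ᵥ w = b ⬝ᵥ w}
  add_mem' := fun hv hw a ha b hb => by
    rw [dotProduct_add, dotProduct_add, hv a ha b hb, hw a ha b hb]
  zero_mem' := fun a _ b _ => by rw [dotProduct_zero, dotProduct_zero]
  smul_mem' := fun c w hw a ha b hb => by rw [dotProduct_smul, dotProduct_smul, hw a ha b hb]

theorem equalSlopes_singleton (a : Fin d → ℝ) : equalSlopes {a} = ⊤ := by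
  refine eq_top_iff.2 fun w _ b hb c hc => ?_
  rw [Finset.mem_singleton.1 hb, Finset.mem_singleton.1 hc]

theorem sub_mem_equalSlopes {A : Finset (Fin d → ℝ)} {x y : Fin d → ℝ} (hx : A ⊆ g.argmax x)
    (hy : A ⊆ g.argmax y) : y - x ∈ equalSlopes A := by
  intro a ha b hb
  have h1 := ((g.mem_argmax).1 (hx ha)).2.trans ((g.mem_argmax).1 (hx hb)).2.symm
  have h2 := ((g.mem_argmax).1 (hy ha)).2.trans ((g.mem_argmax).1 (hy hb)).2.symm
  simp only [monomial] at h1 h2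
  rw [dotProduct_sub, dotProduct_sub]
  linarith

theorem relOpenConvex_stratum (A : Finset (Fin d → ℝ)) :
    RelOpenConvex {y | g.argmax y = A} (equalSlopes A) := by
  constructor
  · rw [convex_iff_forall_pos]
    rintro x rfl y hy s t hs ht hst
    obtain ⟨c, hc⟩ := g.argmax_nonempty x
    have hy' : g.argmax y = g.argmax x := hy
    ext a
    rw [g.argmax_combo hs ht hst hc (hy' ▸ hc), hy', and_self]
  · rintro x rfl w
    constructor
    · intro hw
      obtain ⟨ε, h, hε⟩ := ((eventually_add_smul (g.eventually_argmax_subset x) w).and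
        self_mem_nhdsWithin).exists
      refine ⟨ε, hε, h.antisymm fun a ha => ?_⟩
      -- Some `c` active at `x` stays active; the others active at `x` have the same slope along `w`
      -- and remain tied with it.
      obtain ⟨c, hc⟩ := g.argmax_nonempty (x + ε • w)
      have hcx := h hc
      rw [mem_argmax] at hc ha ⊢
      refine ⟨ha.1, ?_⟩
      rw [← hc.2, monomial_add_smul, monomial_add_smul, ha.2, ((g.mem_argmax).1 hcx).2,
        hw a ((g.mem_argmax).2 ha) c hcx]
    · rintro ⟨ε, hε, h⟩
      have h' : g.argmax (x + ε • w) = g.argmax x := h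
      have := g.sub_mem_equalSlopes subset_rfl h'.ge
      rw [add_sub_cancel_left] at this
      exact ((equalSlopes _).smul_mem_iff (ne_of_gt hε)).1 this

/-- The affine function given by a monomial. -/
def monomialAffine (a : Fin d → ℝ) : (Fin d → ℝ) →ᵃ[ℝ] ℝ where
  toFun := g.monomial a
  linear :=
    { toFun := fun w => a ⬝ᵥ w
      map_add' := dotProduct_add a
      map_smul' := fun c w => dotProduct_smul c a w }
  map_vadd' x w := by
    change g.coeff a + a ⬝ᵥ (w + x) = a ⬝ᵥ w + (g.coeff a + a ⬝ᵥ x)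
    rw [dotProduct_add]
    ring

theorem eventually_eval_eq_monomial {x a : Fin d → ℝ} (h : g.argmax x = {a}) :
    ∀ᶠ y in 𝓝 x, g.eval y = g.monomialAffine a y := by
  filter_upwards [g.eventually_argmax_subset x] with y hy
  obtain ⟨c, hc⟩ := g.argmax_nonempty y
  have hca : c = a := by simpa [h] using hy hc
  rw [hca] at hc
  exact ((g.mem_argmax).1 hc).2.symm

/-- If `g` is locally affine at `x`, that affine function dominates each active monomial and equals
it at `x`, so all active slopes agree, and exponents are determined by their slopes. -/
theorem notMem_nonlinearLocus_eval_iff {x : Fin d → ℝ} :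
    x ∉ nonlinearLocus g.eval ↔ ∃ a, g.argmax x = {a} := by
  constructor
  · intro hx
    obtain ⟨l, hl⟩ := not_not.1 hx
    have hle : ∀ a ∈ g.argmax x, ∀ w, a ⬝ᵥ w ≤ l.linear w := by
      intro a ha w
      obtain ⟨ε, h, hε⟩ := ((eventually_add_smul hl w).and self_mem_nhdsWithin).exists
      rw [mem_argmax] at ha
      have h1 := g.monomial_le_eval ha.1 (x + ε • w)
      have e : l (x + ε • w) = ε * l.linear w + l x := by
        rw [add_comm, ← vadd_eq_add, AffineMap.map_vadd, map_smul, smul_eq_mul, vadd_eq_add]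
      rw [h, e, monomial_add_smul, ha.2, hl.self_of_nhds] at h1
      exact le_of_mul_le_mul_left (by linarith) hε
    have heq : ∀ a ∈ g.argmax x, ∀ w, a ⬝ᵥ w = l.linear w := by
      intro a ha w
      refine le_antisymm (hle a ha w) ?_
      have := hle a ha (-w)
      rw [dotProduct_neg, map_neg] at this
      linarith
    obtain ⟨a, ha⟩ := g.argmax_nonempty x
    refine ⟨a, Finset.eq_singleton_iff_unique_mem.2 ⟨ha, fun b hb => ?_⟩⟩
    exact dotProduct_eq _ _ fun w => (heq b hb w).trans (heq a ha w).symm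
  · rintro ⟨a, ha⟩ hx
    exact hx ⟨_, g.eventually_eval_eq_monomial ha⟩

theorem mem_nonlinearLocus_eval_iff {x : Fin d → ℝ} :
    x ∈ nonlinearLocus g.eval ↔ 1 < (g.argmax x).card := by
  have h0 := (g.argmax_nonempty x).card_pos
  rw [← not_not (a := x ∈ _), notMem_nonlinearLocus_eval_iff, ← Finset.card_eq_one]
  omega

theorem not_redundant_iff {a : Fin d → ℝ} :
    ¬ g.Redundant a ↔ {x | g.argmax x = {a}}.Nonempty := by
  constructor
  · intro h
    by_cases hne : (g.exponents.erase a).Nonempty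
    · have h' : ¬ ∀ x, ((g.exponents.erase a).sup' hne fun b => g.monomial b x) = g.eval x :=
        fun h' => h ⟨hne, h'⟩
      obtain ⟨x, hx⟩ := not_forall.1 h'
      refine ⟨x, (Finset.eq_singleton_iff_nonempty_unique_mem).2
        ⟨g.argmax_nonempty x, fun b hb => ?_⟩⟩
      by_contra hba
      rw [mem_argmax] at hb
      refine hx (le_antisymm (Finset.sup'_le _ _ fun c hc =>
        g.monomial_le_eval (Finset.mem_of_mem_erase hc) x) ?_)
      rw [← hb.2]
      exact Finset.le_sup' (fun b => g.monomial b x) (Finset.mem_erase.2 ⟨hba, hb.1⟩)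
    · refine ⟨0, (Finset.eq_singleton_iff_nonempty_unique_mem).2
        ⟨g.argmax_nonempty 0, fun b hb => ?_⟩⟩
      by_contra hba
      exact hne ⟨b, Finset.mem_erase.2 ⟨hba, g.argmax_subset 0 hb⟩⟩
  · rintro ⟨x, hx⟩ ⟨hne, h⟩
    obtain ⟨b, hb, hbx⟩ := Finset.exists_mem_eq_sup' hne fun b => g.monomial b x
    rw [h] at hbx
    have hmem : b ∈ g.argmax x :=
      (g.mem_argmax).2 ⟨Finset.mem_of_mem_erase hb, hbx.symm⟩
    have hx' : g.argmax x = {a} := hx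
    rw [hx', Finset.mem_singleton] at hmem
    exact Finset.ne_of_mem_erase hb hmem

open Classical in
theorem mlen_eq : g.mlen =
    (g.exponents.filter fun a => {x | g.argmax x = {a}}.Nonempty).card := by
  unfold mlen
  congr 1
  exact Finset.filter_congr fun _ _ => g.not_redundant_iff

theorem isOpen_smooth : IsOpen {x | ∃ a, g.argmax x = {a}} := by
  rw [isOpen_iff_eventually]
  rintro x ⟨a, ha⟩
  filter_upwards [g.eventually_argmax_subset x] with y hy
  rw [ha] at hy
  exact ⟨a, (Finset.Nonempty.subset_singleton_iff (g.argmax_nonempty y)).1 hy⟩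

/-- In an open set, take a point with the fewest active monomials: a tie there could be broken by a
small move. -/
theorem dense_smooth : Dense {x | ∃ a, g.argmax x = {a}} := by
  rw [dense_iff_inter_open]
  intro U hU hne
  obtain ⟨x, hxU, hmin⟩ := WellFounded.has_min (measure fun x => (g.argmax x).card).wf U hne
  refine ⟨x, hxU, ?_⟩
  obtain ⟨a, ha⟩ := g.argmax_nonempty x
  refine ⟨a, Finset.eq_singleton_iff_unique_mem.2 ⟨ha, fun b hb => ?_⟩⟩
  by_contra hba
  obtain ⟨ε, ⟨h1, h2⟩, hε⟩ := (((eventually_add_smul (g.eventually_argmax_subset x) (a - b)).and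
    (eventually_add_smul (hU.mem_nhds hxU) (a - b))).and self_mem_nhdsWithin).exists
  refine hmin _ h2 (Finset.card_lt_card (Finset.ssubset_iff_subset_ne.2 ⟨h1, fun h => ?_⟩))
  -- Along `a - b` the monomial `a` outgrows `b` at rate `|a - b|² > 0`, so `b` cannot remain
  -- active.
  rw [← h, mem_argmax, monomial_add_smul] at hb
  have hle := g.monomial_le_eval (g.argmax_subset x ha) (x + ε • (a - b))
  rw [monomial_add_smul, ← hb.2, ((g.mem_argmax).1 ha).2] at hle
  have hbx := g.monomial_le_eval hb.1 x
  have hpos : 0 < (a - b) ⬝ᵥ (a - b) := by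
    refine lt_of_le_of_ne (Finset.sum_nonneg fun i _ => mul_self_nonneg _) fun h0 => hba ?_
    exact (sub_eq_zero.1 (dotProduct_self_eq_zero.1 h0.symm)).symm
  rw [sub_dotProduct] at hpos
  have := mul_pos hε hpos
  linarith

end TropicalSignomial

/-! ### The common subdivision and its Euler characteristic -/

namespace TropicalSignomial

variable {d : ℕ} (g h : TropicalSignomial d)

/-- The sets of monomials which may attain the maximum together at a point of the hypersurface. -/
def multiples : Finset (Finset (Fin d → ℝ)) :=
  g.exponents.powerset.filter fun A => 1 < A.card

theorem argmax_mem_multiples {x : Fin d → ℝ} :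
    g.argmax x ∈ g.multiples ↔ x ∈ nonlinearLocus g.eval := by
  rw [mem_nonlinearLocus_eval_iff, multiples, Finset.mem_filter, Finset.mem_powerset]
  exact and_iff_right (g.argmax_subset x)

theorem sum_indicator_multiples (x : Fin d → ℝ) :
    ∑ A ∈ g.multiples, {y | g.argmax y = A}.indicator (1 : (Fin d → ℝ) → ℚ) x =
      1 - ∑ a ∈ g.exponents, {y | g.argmax y = {a}}.indicator (1 : (Fin d → ℝ) → ℚ) x := by
  classical
  simp only [Set.indicator_apply, Set.mem_ofPred_eq, Pi.one_apply]
  rw [Finset.sum_ite_eq]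
  by_cases hx : x ∈ nonlinearLocus g.eval
  · have h1 : ∀ a, g.argmax x ≠ {a} := fun a ha =>
      (g.notMem_nonlinearLocus_eval_iff).2 ⟨a, ha⟩ hx
    simp [h1, (g.argmax_mem_multiples).2 hx]
  · obtain ⟨a, ha⟩ := (g.notMem_nonlinearLocus_eval_iff).1 hx
    have h2 : {a} ∉ g.multiples := by simp [multiples]
    have h3 : a ∈ g.exponents := g.argmax_subset x (by simp [ha])
    simp [ha, h2, h3]

/-- The closed cell of the common subdivision where at least the monomials in `p.1` and `p.2`
attain the maxima. -/
def commonCell (p : Finset (Fin d → ℝ) × Finset (Fin d → ℝ)) : Set (Fin d → ℝ) :=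
  {y | p.1 ⊆ g.argmax y} ∩ {y | p.2 ⊆ h.argmax y}

/-- The relative interior of `commonCell`. -/
def commonStratum (p : Finset (Fin d → ℝ) × Finset (Fin d → ℝ)) : Set (Fin d → ℝ) :=
  {y | g.argmax y = p.1} ∩ {y | h.argmax y = p.2}

theorem commonStratum_subset (p : Finset (Fin d → ℝ) × Finset (Fin d → ℝ)) :
    commonStratum g h p ⊆ commonCell g h p :=
  fun _ hy => ⟨hy.1.ge, hy.2.ge⟩

theorem relOpenConvex_commonStratum (p : Finset (Fin d → ℝ) × Finset (Fin d → ℝ)) :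
    RelOpenConvex (commonStratum g h p) (equalSlopes p.1 ⊓ equalSlopes p.2) :=
  (g.relOpenConvex_stratum p.1).inter (h.relOpenConvex_stratum p.2)

theorem cellDim_commonCell {p : Finset (Fin d → ℝ) × Finset (Fin d → ℝ)}
    (hp : (commonStratum g h p).Nonempty) :
    cellDim (commonCell g h p) =
      Module.finrank ℝ (equalSlopes p.1 ⊓ equalSlopes p.2 : Submodule ℝ (Fin d → ℝ)) := by
  suffices h : vectorSpan ℝ (commonCell g h p) = equalSlopes p.1 ⊓ equalSlopes p.2 by
    rw [cellDim, h]
  refine le_antisymm (Submodule.span_le.2 ?_) fun w hw => ?_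
  · rintro - ⟨x, hx, y, hy, rfl⟩
    exact ⟨g.sub_mem_equalSlopes hy.1 hx.1, h.sub_mem_equalSlopes hy.2 hx.2⟩
  · obtain ⟨x, hx⟩ := hp
    obtain ⟨ε, hε, hxw⟩ := ((relOpenConvex_commonStratum g h p).2 x hx w).1 hw
    have := vsub_mem_vectorSpan ℝ (commonStratum_subset g h p hxw)
      (commonStratum_subset g h p hx)
    rw [vsub_eq_sub, add_sub_cancel_left] at this
    exact ((vectorSpan ℝ _).smul_mem_iff hε.ne').1 this

/-- At a point of the stratum the active sets are exactly `p`, so the cell determines `p`. -/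
theorem commonCell_injOn : Set.InjOn (commonCell g h) {p | (commonStratum g h p).Nonempty} := by
  have key : ∀ p q, (commonStratum g h p).Nonempty → commonCell g h p = commonCell g h q →
      q.1 ⊆ p.1 ∧ q.2 ⊆ p.2 := by
    rintro p q ⟨x, hx⟩ hpq
    have hxq : x ∈ commonCell g h q := hpq ▸ commonStratum_subset g h p hx
    exact ⟨hxq.1.trans hx.1.le, hxq.2.trans hx.2.le⟩
  intro p hp q hq hpq
  have h1 := key p q hp hpq
  have h2 := key q p hq hpq.symm
  exact Prod.ext (h2.1.antisymm h1.1) (h2.2.antisymm h1.2)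

open Classical in
theorem complexInter_eq_image : complexInter g.hypersurface h.hypersurface =
    commonCell g h '' ((g.multiples ×ˢ h.multiples).filter fun p =>
      (commonStratum g h p).Nonempty : Finset _) := by
  ext R
  constructor
  · rintro ⟨hne, -, ⟨u, hu, rfl⟩, -, ⟨v, hv, rfl⟩, rfl⟩
    -- A point of the intersection with the fewest active monomials lies in its relative interior.
    obtain ⟨x, hx, hmin⟩ := WellFounded.has_min
      (measure fun x => (g.argmax x).card + (h.argmax x).card).wf _ hne
    have hxu : g.argmax u ⊆ g.argmax x := hx.1
    have hxv : h.argmax v ⊆ h.argmax x := hx.2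
    refine ⟨(g.argmax x, h.argmax x), ?_, ?_⟩
    · rw [Finset.mem_coe, Finset.mem_filter, Finset.mem_product, argmax_mem_multiples,
        argmax_mem_multiples]
      rw [mem_nonlinearLocus_eval_iff] at hu hv
      exact ⟨⟨(g.mem_nonlinearLocus_eval_iff).2 (hu.trans_le (Finset.card_le_card hxu)),
        (h.mem_nonlinearLocus_eval_iff).2 (hv.trans_le (Finset.card_le_card hxv))⟩, x, rfl, rfl⟩
    · refine Set.Subset.antisymm
        (fun y hy => ⟨hxu.trans hy.1, hxv.trans hy.2⟩) fun y hy => ?_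
      obtain ⟨a, ha⟩ := g.argmax_nonempty u
      obtain ⟨b, hb⟩ := h.argmax_nonempty v
      -- The midpoint of `x` and `y` stays in the intersection with active sets inside those of `x`;
      -- minimality forces equality, so everything active at `x` is active at `y`.
      have hga : ∀ c, c ∈ g.argmax ((1 / 2 : ℝ) • x + (1 / 2 : ℝ) • y) ↔ _ := fun c =>
        g.argmax_combo (by norm_num) (by norm_num) (by norm_num) (hx.1 ha) (hy.1 ha)
      have hhb : ∀ c, c ∈ h.argmax ((1 / 2 : ℝ) • x + (1 / 2 : ℝ) • y) ↔ _ := fun c =>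
        h.argmax_combo (by norm_num) (by norm_num) (by norm_num) (hx.2 hb) (hy.2 hb)
      set m := (1 / 2 : ℝ) • x + (1 / 2 : ℝ) • y
      have hgm : g.argmax m ⊆ g.argmax x := fun c hc => ((hga c).1 hc).1
      have hhm : h.argmax m ⊆ h.argmax x := fun c hc => ((hhb c).1 hc).1
      have hle : (g.argmax x).card + (h.argmax x).card ≤
          (g.argmax m).card + (h.argmax m).card :=
        not_lt.1 (hmin m ⟨fun c hc => (hga c).2 ⟨hx.1 hc, hy.1 hc⟩,
          fun c hc => (hhb c).2 ⟨hx.2 hc, hy.2 hc⟩⟩)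
      have h1 := Finset.card_le_card hgm
      have h2 := Finset.card_le_card hhm
      have h3 := Finset.eq_of_subset_of_card_le hgm (by omega)
      have h4 := Finset.eq_of_subset_of_card_le hhm (by omega)
      exact ⟨fun c hc => ((hga c).1 (h3 ▸ hc)).2, fun c hc => ((hhb c).1 (h4 ▸ hc)).2⟩
  · rintro ⟨⟨A, B⟩, hp, rfl⟩
    rw [Finset.mem_coe, Finset.mem_filter, Finset.mem_product] at hp
    obtain ⟨⟨hA, hB⟩, x, hx⟩ := hp
    obtain ⟨rfl, rfl⟩ : g.argmax x = A ∧ h.argmax x = B := id hx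
    exact ⟨⟨x, commonStratum_subset g h _ hx⟩, _, ⟨x, (g.argmax_mem_multiples).1 hA, rfl⟩, _,
      ⟨x, (h.argmax_mem_multiples).1 hB, rfl⟩, rfl⟩

open Classical in
theorem eulerChar_complexInter : eulerChar (complexInter g.hypersurface h.hypersurface) =
    ∑ p ∈ (g.multiples ×ˢ h.multiples).filter fun p => (commonStratum g h p).Nonempty,
      (-1 : ℤ) ^ Module.finrank ℝ
        (equalSlopes p.1 ⊓ equalSlopes p.2 : Submodule ℝ (Fin d → ℝ)) := by
  rw [eulerChar, complexInter_eq_image, finsum_mem_image, finsum_mem_coe_finset]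
  · refine Finset.sum_congr rfl fun p hp => ?_
    rw [cellDim_commonCell g h (Finset.mem_filter.1 hp).2]
  · refine (commonCell_injOn g h).mono fun p hp => ?_
    exact (Finset.mem_filter.1 (Finset.mem_coe.1 hp)).2

open Classical in
/-- The pairs of monomials of `g` and `h` which attain the maxima alone at a common point. -/
noncomputable def commonRegions : Finset ((Fin d → ℝ) × (Fin d → ℝ)) :=
  (g.exponents ×ˢ h.exponents).filter fun p => (commonStratum g h ({p.1}, {p.2})).Nonempty

/-- Apply the Euler functional to the expanded product `(1 - ∑ₐ 1_{Gₐ})(1 - ∑_b 1_{H_b})`; the open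
strata all contribute `(-1)^d`, and empty ones contribute nothing. -/
theorem card_commonRegions : ((commonRegions g h).card : ℤ) = g.mlen + h.mlen - 1 +
    (-1) ^ d * eulerChar (complexInter g.hypersurface h.hypersurface) := by
  classical
  obtain ⟨E, hE⟩ := exists_eulerFunctional d
  have hE' : ∀ C W, RelOpenConvex C W →
      E (C.indicator 1) = if C.Nonempty then (-1) ^ Module.finrank ℝ W else 0 := by
    intro C W hC
    split_ifs with hne
    · exact hE C W hC hne
    · rw [Set.not_nonempty_iff_eq_empty.1 hne, Set.indicator_empty', map_zero]
  have hfun : ∑ p ∈ g.multiples ×ˢ h.multiples, (commonStratum g h p).indicator 1 =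
      Set.univ.indicator 1 -
        ∑ a ∈ g.exponents, {y | g.argmax y = {a}}.indicator (1 : (Fin d → ℝ) → ℚ) -
        ∑ b ∈ h.exponents, {y | h.argmax y = {b}}.indicator (1 : (Fin d → ℝ) → ℚ) +
        ∑ p ∈ g.exponents ×ˢ h.exponents, (commonStratum g h ({p.1}, {p.2})).indicator 1 := by
    funext x
    simp only [Finset.sum_apply, Pi.add_apply, Pi.sub_apply, commonStratum,
      Set.inter_indicator_one, Pi.mul_apply]
    rw [Finset.sum_product, Finset.sum_product]
    dsimp only
    rw [← Finset.sum_mul_sum, ← Finset.sum_mul_sum,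
      sum_indicator_multiples, sum_indicator_multiples]
    simp only [Set.indicator_univ, Pi.one_apply]
    ring
  have hsum := congrArg E hfun
  have hsingle : ∀ f : TropicalSignomial d,
      ∑ a ∈ f.exponents, E ({y | f.argmax y = {a}}.indicator 1) = f.mlen * (-1) ^ d := by
    intro f
    rw [f.mlen_eq, ← nsmul_eq_mul, ← Finset.sum_const, Finset.sum_filter]
    refine Finset.sum_congr rfl fun a _ => ?_
    rw [hE' _ _ (f.relOpenConvex_stratum {a}), equalSlopes_singleton, finrank_top,
      Module.finrank_fin_fun]
  have hpair : ∑ p ∈ g.exponents ×ˢ h.exponents,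
      E ((commonStratum g h ({p.1}, {p.2})).indicator 1) =
        (commonRegions g h).card * (-1) ^ d := by
    rw [commonRegions, ← nsmul_eq_mul, ← Finset.sum_const, Finset.sum_filter]
    refine Finset.sum_congr rfl fun p _ => ?_
    rw [hE' _ _ (relOpenConvex_commonStratum g h _), equalSlopes_singleton,
      equalSlopes_singleton, inf_top_eq, finrank_top, Module.finrank_fin_fun]
  have hcells : ∑ p ∈ g.multiples ×ˢ h.multiples, E ((commonStratum g h p).indicator 1) =
      (eulerChar (complexInter g.hypersurface h.hypersurface) : ℚ) := by
    rw [eulerChar_complexInter, Finset.sum_filter, Int.cast_sum]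
    refine Finset.sum_congr rfl fun p _ => ?_
    rw [hE' _ _ (relOpenConvex_commonStratum g h p)]
    split_ifs <;> simp
  rw [map_add, map_sub, map_sub, map_sum, map_sum, map_sum, map_sum, hsingle, hsingle, hpair,
    hcells, hE _ _ relOpenConvex_univ Set.univ_nonempty, finrank_top,
    Module.finrank_fin_fun] at hsum
  have hsq : ((-1 : ℚ) ^ d) * (-1) ^ d = 1 := by rw [← mul_pow]; simp
  have : ((commonRegions g h).card : ℚ) = g.mlen + h.mlen - 1 +
      (-1) ^ d * (eulerChar (complexInter g.hypersurface h.hypersurface) : ℚ) := by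
    rw [hsum]
    linear_combination (g.mlen + h.mlen - 1 - ((commonRegions g h).card : ℚ)) * hsq
  exact_mod_cast this

end TropicalSignomial

/-! ### Linear regions of the difference -/

theorem isOpen_compl_nonlinearLocus {d : ℕ} (f : (Fin d → ℝ) → ℝ) :
    IsOpen (nonlinearLocus f)ᶜ := by
  rw [isOpen_iff_eventually]
  intro x hx
  obtain ⟨l, hl⟩ := not_not.1 hx
  filter_upwards [hl.eventually_nhds] with y hy
  exact not_not.2 ⟨l, hy⟩

-- A region is open, so by density it meets a common region of `g` and `h`. That stratum is
-- connected and avoids `𝒱(φ)`, so it determines the region.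
open TropicalSignomial in
theorem linearRegions_subset_image {d : ℕ} (g h : TropicalSignomial d) (φ : (Fin d → ℝ) → ℝ)
    (hφ : ∀ x, φ x = g.eval x - h.eval x) :
    ∃ F : (Fin d → ℝ) × (Fin d → ℝ) → Set (Fin d → ℝ),
      linearRegions φ ⊆ F '' (commonRegions g h) := by
  classical
  have hsub : ∀ a b, commonStratum g h ({a}, {b}) ⊆ (nonlinearLocus φ)ᶜ := by
    rintro a b x ⟨ha, hb⟩
    refine not_not.2 ⟨g.monomialAffine a - h.monomialAffine b, ?_⟩
    filter_upwards [g.eventually_eval_eq_monomial ha, h.eventually_eval_eq_monomial hb] with y h1 h2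
    rw [hφ, h1, h2]
    rfl
  have hU := isOpen_compl_nonlinearLocus φ
  -- Any point of the stratum yields the same component; the value `∅` is never used on
  -- `commonRegions`.
  refine ⟨fun p => if hp : (commonStratum g h ({p.1}, {p.2})).Nonempty then
    connectedComponentIn (nonlinearLocus φ)ᶜ hp.some else ∅, ?_⟩
  rintro - ⟨x, hx, rfl⟩
  obtain ⟨y, hyU, ⟨a, ha⟩, b, hb⟩ :=
    (g.dense_smooth.inter_of_isOpen_left h.dense_smooth g.isOpen_smooth).inter_open_nonempty _
      (hU.connectedComponentIn (x := x)) ⟨x, mem_connectedComponentIn hx⟩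
  have hy : y ∈ commonStratum g h ({a}, {b}) := ⟨ha, hb⟩
  have hne : (commonStratum g h ({a}, {b})).Nonempty := ⟨y, hy⟩
  refine ⟨(a, b), ?_, ?_⟩
  · rw [Finset.mem_coe, commonRegions, Finset.mem_filter, Finset.mem_product]
    exact ⟨⟨g.argmax_subset y (by simp [ha]), h.argmax_subset y (by simp [hb])⟩, hne⟩
  · dsimp only
    rw [dif_pos hne, connectedComponentIn_eq hyU]
    exact (connectedComponentIn_eq ((relOpenConvex_commonStratum g h _).1.isPreconnected
      |>.subset_connectedComponentIn hy (hsub a b) hne.some_mem)).symm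

theorem mainTheorem11 (d : ℕ) (g h : TropicalSignomial d) (φ : (Fin d → ℝ) → ℝ)
    (hφ : ∀ x, φ x = g.eval x - h.eval x) :
    (linearRegions φ).Finite ∧
      ((linearRegions φ).ncard : ℤ) ≤
        (g.mlen : ℤ) + (h.mlen : ℤ) +
          (-1 : ℤ) ^ (d + 2) * eulerChar (complexInter g.hypersurface h.hypersurface) := by
  obtain ⟨F, hF⟩ := linearRegions_subset_image g h φ hφ
  have hfin := (TropicalSignomial.commonRegions g h).finite_toSet.image F
  refine ⟨hfin.subset hF, ?_⟩
  have h1 : (linearRegions φ).ncard ≤ (TropicalSignomial.commonRegions g h).card := by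
    refine (Set.ncard_le_ncard hF hfin).trans ?_
    rw [← Set.ncard_coe_finset]
    exact Set.ncard_image_le (Finset.finite_toSet _)
  have h2 := TropicalSignomial.card_commonRegions g h
  rw [pow_add, neg_one_sq, mul_one]
  -- The exact count carries an extra `-1`, which is dropped here.
  omega
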